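/- All rings are commutative with $1$. A quasi-identity is a universally quantified implication $(s_1=t_1)\wedge\cdots\wedge(s_k=t_k)\to(s_0=t_0)$ between terms in the operations $+,\cdot,-,0,1$ ($k=0$ is allowed and gives an identity). A quasivariety is a class of algebras in these operations axiomatized by a set of quasi-identities, and the quasivariety generated by a class is the smallest quasivariety containing it. If $\mathcal Q$ is a quasivariety of commutative rings and $R\in\mathcal Q$, then an ideal $I$ of $R$ is a $\mathcal Q$-ideal if $R/I\in\mathcal Q$; the $\mathcal Q$-ideals of $R$, ordered by inclusion, form a lattice in which $I\wedge J=I\cap J$ and $I\vee J$ is the least $\mathcal Q$-ideal containing $I\cup J$. The quasivariety $\mathcal Q$ is relatively ideal distributive if for every $R\in\mathcal Q$ this lattice satisfies $I\wedge(J\vee K)=(I\wedge J)\vee(I\wedge K)$. Theorem. Let $n$ be a positive integer, and let $\mathcal Q_{|n}$ be the quasivariety generated by the class of integral domains whose group of units is cyclic of order dividing $n$. (1) $\mathcal Q_{|n}$ is axiomatized by (a) the identities defining commutative rings, (b) the quasi-identity $(x^2=0)\to(x=0)$, and (c) the quasi-identity $(xyz=z)\to(y^nz=z)$. (2) $\mathcal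 Q_{|n}$ is a relatively ideal distributive quasivariety. -/

import Mathlib

universe u

namespace RingQuasivariety

open FirstOrder

/-- Terms in the language `{+, *, -, 0, 1}` of rings, in countably many variables. -/
abbrev RingTerm : Type := Language.ring.Term ℕ

/-- Algebras in the language of rings: a type with operations `+, *, -, 0, 1`, no laws assumed.
A class of algebras is a term of type `Set RingAlg`. -/
abbrev RingAlg : Type (u + 1) := CategoryTheory.Bundled.{u} Language.ring.Structure

/-- The algebra in the language of rings underlying a commutative ring. -/
def algOf (R : Type u) [CommRing R] : RingAlg.{u} :=
  ⟨R, (Ring.compatibleRingOfRing R).toStructure⟩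

/-- A quasi-identity `(s₁ = t₁) ∧ ... ∧ (s_k = t_k) → (s₀ = t₀)`; the list of premises may be
empty, and then the quasi-identity is an identity. -/
structure QuasiIdentity where
  /-- the pairs `(s_i, t_i)` for `1 ≤ i ≤ k` -/
  premises : List (RingTerm × RingTerm)
  /-- the pair `(s₀, t₀)` -/
  conclusion : RingTerm × RingTerm

/-- The universally quantified quasi-identity `q` holds in the algebra `A`. -/
def QuasiIdentity.Holds (q : QuasiIdentity) (A : RingAlg.{u}) : Prop :=
  letI := A.str
  ∀ v : ℕ → A.α, (∀ e ∈ q.premises, e.1.realize v = e.2.realize v) →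
    q.conclusion.1.realize v = q.conclusion.2.realize v

/-- An identity `s = t`, that is, a quasi-identity without premises. -/
def identity (s t : RingTerm) : QuasiIdentity := ⟨[], (s, t)⟩

/-- The class of algebras axiomatized by a set of quasi-identities. -/
def axiomatizedBy (T : Set QuasiIdentity) : Set RingAlg.{u} :=
  {A | ∀ q ∈ T, q.Holds A}

/-- A quasivariety is a class axiomatized by quasi-identities. -/
def IsQuasivariety (Q : Set RingAlg.{u}) : Prop :=
  ∃ T : Set QuasiIdentity, Q = axiomatizedBy T

/-- The quasivariety generated by a class: the intersection of all quasivarieties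
containing it. -/
def generatedQuasivariety (K : Set RingAlg.{u}) : Set RingAlg.{u} :=
  ⋂₀ {Q | IsQuasivariety Q ∧ K ⊆ Q}

/-- The domains whose unit group is (finite) cyclic of order dividing `n`, where `0 < n`. -/
def domainsUnitsDvd (n : ℕ) : Set RingAlg.{u} :=
  {A | ∃ (D : Type u) (_ : CommRing D),
    IsDomain D ∧ IsCyclic Dˣ ∧ Nat.card Dˣ ∣ n ∧ A = algOf D}

/-- The quasivariety generated by the domains whose unit group is cyclic of order
dividing `n`. -/
def quasivarietyUnitsDvd (n : ℕ) : Set RingAlg.{u} :=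
  generatedQuasivariety (domainsUnitsDvd n)

/-- The variables. -/
abbrev X (i : ℕ) : RingTerm := Language.Term.var i

/-- The term `t ^ n`, i.e. `((1 * t) * t) * ... * t`. -/
def powTerm (t : RingTerm) : ℕ → RingTerm
  | 0 => 1
  | n + 1 => powTerm t n * t

/-- The identities defining commutative rings (with `1`). -/
def commRingIdentities : Set QuasiIdentity :=
  { identity ((X 0 + X 1) + X 2) (X 0 + (X 1 + X 2)),
    identity (X 0 + X 1) (X 1 + X 0),
    identity (0 + X 0) (X 0),
    identity (-X 0 + X 0) 0,
    identity ((X 0 * X 1) * X 2) (X 0 * (X 1 * X 2)),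
    identity (X 0 * X 1) (X 1 * X 0),
    identity (1 * X 0) (X 0),
    identity (X 0 * (X 1 + X 2)) (X 0 * X 1 + X 0 * X 2) }

/-- The quasi-identity `(x² = 0) → (x = 0)`. -/
def reducedAxiom : QuasiIdentity := ⟨[(X 0 * X 0, 0)], (X 0, 0)⟩

/-- The quasi-identity `(x y z = z) → (yⁿ z = z)`. -/
def unitPowAxiom (n : ℕ) : QuasiIdentity :=
  ⟨[(X 0 * X 1 * X 2, X 2)], (powTerm (X 1) n * X 2, X 2)⟩

/-- `I` is a relative ideal (a `Q`-ideal) of the commutative ring `R`: `R ⧸ I` lies in `Q`. -/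
def IsRelIdeal (Q : Set RingAlg.{u}) {R : Type u} [CommRing R] (I : Ideal R) : Prop :=
  algOf (R ⧸ I) ∈ Q

/-- The join in the lattice of `Q`-ideals: the least `Q`-ideal containing `I` and `J`
(see `isLeast_relJoin`). -/
def relJoin (Q : Set RingAlg.{u}) {R : Type u} [CommRing R] (I J : Ideal R) : Ideal R :=
  sInf {K | IsRelIdeal Q K ∧ I ≤ K ∧ J ≤ K}

/-- `Q` is a relatively ideal distributive quasivariety: for every commutative ring `R` in `Q`,
the lattice of `Q`-ideals of `R` (with intersection as meet and `relJoin` as join)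
is distributive. -/
def RelativelyIdealDistributive (Q : Set RingAlg.{u}) : Prop :=
  IsQuasivariety Q ∧
    ∀ (R : Type u) [CommRing R], algOf R ∈ Q →
      ∀ I J K : Ideal R, IsRelIdeal Q I → IsRelIdeal Q J → IsRelIdeal Q K →
        I ⊓ relJoin Q J K = relJoin Q (I ⊓ J) (I ⊓ K)

/-! The join is well defined: intersections of relative ideals are relative ideals. -/

theorem holds_algOf (q : QuasiIdentity) (R : Type u) [CommRing R] :
    q.Holds (algOf R) ↔
      letI := Ring.compatibleRingOfRing R
      ∀ v : ℕ → R, (∀ e ∈ q.premises, e.1.realize v = e.2.realize v) →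
        q.conclusion.1.realize v = q.conclusion.2.realize v :=
  Iff.rfl

theorem realize_mk {R : Type u} [CommRing R] (I : Ideal R) (w : ℕ → R) (t : RingTerm) :
    letI := Ring.compatibleRingOfRing R
    letI := Ring.compatibleRingOfRing (R ⧸ I)
    t.realize (fun i => Ideal.Quotient.mk I (w i)) = Ideal.Quotient.mk I (t.realize w) := by
  induction t with
  | var i => rfl
  | func f ts ih =>
    cases f
    · exact (congrArg₂ (fun a b : R ⧸ I => a + b) (ih 0) (ih 1)).trans
        (map_add (Ideal.Quotient.mk I) _ _).symm
    · exact (congrArg₂ (fun a b : R ⧸ I => a * b) (ih 0) (ih 1)).trans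
        (map_mul (Ideal.Quotient.mk I) _ _).symm
    · exact (congrArg (fun a : R ⧸ I => -a) (ih 0)).trans (map_neg (Ideal.Quotient.mk I) _).symm
    · exact (map_zero (Ideal.Quotient.mk I)).symm
    · exact (map_one (Ideal.Quotient.mk I)).symm

theorem IsRelIdeal.sInf {Q : Set RingAlg.{u}} (hQ : IsQuasivariety Q) {R : Type u} [CommRing R]
    {S : Set (Ideal R)} (hS : ∀ K ∈ S, IsRelIdeal Q K) : IsRelIdeal Q (sInf S) := by
  obtain ⟨T, rfl⟩ := hQ
  intro q hq
  rw [holds_algOf]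
  intro v hv
  obtain ⟨w, rfl⟩ : ∃ w : ℕ → R, v = fun i => Ideal.Quotient.mk (InfSet.sInf S) (w i) := by
    choose w hw using fun i => Ideal.Quotient.mk_surjective (I := InfSet.sInf S) (v i)
    exact ⟨w, funext fun i => (hw i).symm⟩
  rw [realize_mk, realize_mk, Ideal.Quotient.mk_eq_mk_iff_sub_mem, Submodule.mem_sInf]
  intro K hK
  rw [← Ideal.Quotient.mk_eq_mk_iff_sub_mem, ← realize_mk, ← realize_mk]
  refine (holds_algOf q _).1 (hS K hK q hq) _ fun e he => ?_
  have h := hv e he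
  rw [realize_mk, realize_mk, Ideal.Quotient.mk_eq_mk_iff_sub_mem] at h ⊢
  exact Submodule.mem_sInf.1 h K hK

theorem isLeast_relJoin {Q : Set RingAlg.{u}} (hQ : IsQuasivariety Q) {R : Type u} [CommRing R]
    (I J : Ideal R) : IsLeast {K | IsRelIdeal Q K ∧ I ≤ K ∧ J ≤ K} (relJoin Q I J) :=
  ⟨⟨IsRelIdeal.sInf hQ fun _ h => h.1, le_sInf fun _ h => h.2.1, le_sInf fun _ h => h.2.2⟩,
    fun _ h => sInf_le h⟩

end RingQuasivariety

/-! A reduced ring embeds in the product of its quotients by minimal primes. If `P` is a minimal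
prime of a reduced ring `R`, each element of `P` is annihilated by an element outside `P`, so an
equation that holds in `R ⧸ P` holds in `R` after multiplication by some `s ∉ P`. The variable `z`
of `(x y z = z) → (yⁿ z = z)` absorbs this `s`, so the quasi-identity passes from `R` to `R ⧸ P`.
There it says that the unit group has exponent dividing `n`, and in a domain this forces the unit
group to be cyclic of order dividing `n`. As quasi-identities are inherited by subrings of products,
the axiomatization follows.

By the same embedding every relative ideal is an intersection of prime relative ideals. A prime that
contains `I ∩ J` and `I ∩ K` contains `I` or both `J` and `K`, which gives distributivity. -/

namespace RingQuasivariety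

open FirstOrder

theorem exists_notMem_mul_mem_of_mem_minimalPrimes {R : Type*} [CommRing R] {I P : Ideal R}
    (hI : I.IsRadical) (hP : P ∈ I.minimalPrimes) {a : R} (ha : a ∈ P) : ∃ s ∉ P, s * a ∈ I := by
  have : P.IsPrime := hP.1.1
  have hrad : algebraMap R (Localization.AtPrime P) a ∈
      (I.map (algebraMap R (Localization.AtPrime P))).radical := by
    rw [IsLocalization.AtPrime.radical_map_of_mem_minimalPrimes _ _ _ hP]
    exact Ideal.mem_map_of_mem _ ha
  obtain ⟨k, hk⟩ := hrad
  rw [← map_pow, IsLocalization.algebraMap_mem_map_algebraMap_iff P.primeCompl] at hk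
  obtain ⟨s, hs, hsa⟩ := hk
  refine ⟨s, hs, hI ⟨k + 1, ?_⟩⟩
  have hpow : (s * a) ^ (k + 1) = s ^ k * a * (s * a ^ k) := by ring
  exact hpow ▸ I.mul_mem_left _ hsa

theorem exists_mem_minimalPrimes_notMem {R : Type*} [CommRing R] [IsReduced R] {a : R}
    (ha : a ≠ 0) : ∃ P ∈ minimalPrimes R, a ∉ P := by
  by_contra! h
  have hrad : a ∈ (⊥ : Ideal R).radical := by
    rw [← Ideal.sInf_minimalPrimes]
    exact Submodule.mem_sInf.2 h
  exact ha (Ideal.isRadical_bot hrad)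

theorem isCyclic_units_and_card_dvd {D : Type*} [CommRing D] [IsDomain D] {n : ℕ} (hn : 0 < n)
    (h : ∀ u : Dˣ, u ^ n = 1) : IsCyclic Dˣ ∧ Nat.card Dˣ ∣ n := by
  have : NeZero n := ⟨hn.ne'⟩
  have htop : rootsOfUnity n D = ⊤ := eq_top_iff.2 fun u _ => h u
  have : Finite (⊤ : Subgroup Dˣ) := htop ▸ (inferInstance : Finite (rootsOfUnity n D))
  have : Finite Dˣ := .of_equiv _ Subgroup.topEquiv.toEquiv
  exact ⟨inferInstance,
    IsCyclic.exponent_eq_card (α := Dˣ) ▸ Monoid.exponent_dvd_of_forall_pow_eq_one h⟩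

/-- The property of a ring expressed by `unitPowAxiom n`: if `y` acts invertibly on `z` by
multiplication, then `y ^ n` fixes `z`. It is stated for monoids, as only multiplication occurs. -/
def LocalUnitsPowEqOne (n : ℕ) (M : Type*) [Monoid M] : Prop :=
  ∀ x y z : M, x * y * z = z → y ^ n * z = z

theorem localUnitsPowEqOne_iff {M : Type*} [CommMonoidWithZero M] [IsCancelMulZero M] {n : ℕ} :
    LocalUnitsPowEqOne n M ↔ ∀ u : Mˣ, u ^ n = 1 := by
  refine ⟨fun h u => Units.ext ?_, fun h x y z hxyz => ?_⟩
  · simpa using h ↑u⁻¹ u 1 (by simp)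
  · obtain rfl | hz := eq_or_ne z 0
    · exact mul_zero _
    have hyx : y * x = 1 := mul_comm y x ▸ (mul_eq_right₀ hz).1 hxyz
    have hy : y ^ n = 1 := congrArg Units.val (h (Units.mkOfMulEqOne y x hyx))
    rw [hy, one_mul]

theorem LocalUnitsPowEqOne.quotient_minimalPrime {R : Type*} [CommRing R] [IsReduced R] {n : ℕ}
    (h : LocalUnitsPowEqOne n R) {P : Ideal R} (hP : P ∈ minimalPrimes R) :
    LocalUnitsPowEqOne n (R ⧸ P) := by
  have : P.IsPrime := hP.1.1
  intro x y z hxyz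
  obtain ⟨x, rfl⟩ := Ideal.Quotient.mk_surjective x
  obtain ⟨y, rfl⟩ := Ideal.Quotient.mk_surjective y
  obtain ⟨z, rfl⟩ := Ideal.Quotient.mk_surjective z
  simp only [← map_mul, ← map_pow, Ideal.Quotient.mk_eq_mk_iff_sub_mem] at hxyz ⊢
  obtain ⟨s, hs, hs_mul⟩ := exists_notMem_mul_mem_of_mem_minimalPrimes Ideal.isRadical_bot hP hxyz
  have hxysz : x * y * (s * z) = s * z := by linear_combination Ideal.mem_bot.1 hs_mul
  have hs_pow : s * (y ^ n * z - z) = 0 := by linear_combination h x y (s * z) hxysz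
  exact (this.mem_or_mem (hs_pow ▸ P.zero_mem)).resolve_left hs

section QuasiIdentities

theorem realize_ringHom_comp {α R S : Type*} [NonAssocRing R] [NonAssocRing S]
    [Ring.CompatibleRing R] [Ring.CompatibleRing S] (f : R →+* S) (v : α → R)
    (t : Language.ring.Term α) : t.realize (f ∘ v) = f (t.realize v) :=
  let g : Language.ring.Hom R S :=
    { toFun := f
      map_fun' := fun s _ => by cases s <;> simp
      map_rel' := fun r => r.elim }
  Language.HomClass.realize_term g

/-- `R` is residually in the class `C`: homomorphisms to rings of `C` separate the elements of `R`
from zero, that is, `R` embeds in a product of rings of `C`. -/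
def IsResidually (C : ∀ (S : Type u) [CommRing S], Prop) (R : Type u) [CommRing R] : Prop :=
  ∀ a : R, a ≠ 0 → ∃ (S : Type u) (_ : CommRing S) (f : R →+* S), C S ∧ f a ≠ 0

variable {C : ∀ (S : Type u) [CommRing S], Prop} {Q : Set RingAlg.{u}} {R S : Type u}
  [CommRing R] [CommRing S]

theorem IsResidually.mono {C' : ∀ (S : Type u) [CommRing S], Prop} (h : IsResidually C R)
    (hC : ∀ (S : Type u) [CommRing S], C S → C' S) : IsResidually C' R := fun a ha =>
  let ⟨S, _, f, hS, hfa⟩ := h a ha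
  ⟨S, _, f, hC S hS, hfa⟩

theorem QuasiIdentity.Holds.of_isResidually {q : QuasiIdentity}
    (h : IsResidually (fun S _ => q.Holds (algOf S)) R) : q.Holds (algOf R) := by
  let := Ring.compatibleRingOfRing R
  rw [holds_algOf]
  intro v hv
  by_contra hne
  obtain ⟨S, _, f, hS, hf⟩ := h _ (sub_ne_zero.2 hne)
  let := Ring.compatibleRingOfRing S
  have hconclusion := (holds_algOf q S).1 hS (f ∘ v) fun e he => by
    rw [realize_ringHom_comp, realize_ringHom_comp, hv e he]
  rw [realize_ringHom_comp, realize_ringHom_comp] at hconclusion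
  exact hf (by rw [map_sub, hconclusion, sub_self])

theorem IsQuasivariety.algOf_mem_of_isResidually (hQ : IsQuasivariety Q)
    (h : IsResidually (fun S _ => algOf S ∈ Q) R) : algOf R ∈ Q := by
  obtain ⟨T, rfl⟩ := hQ
  exact fun q hq => .of_isResidually (h.mono fun S _ hS => hS q hq)

theorem IsQuasivariety.isRelIdeal_ker (hQ : IsQuasivariety Q) (hS : algOf S ∈ Q) (f : R →+* S) :
    IsRelIdeal Q (RingHom.ker f) :=
  hQ.algOf_mem_of_isResidually fun _ ha =>
    ⟨S, _, f.kerLift, hS, (map_ne_zero_iff _ f.kerLift_injective).2 ha⟩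

theorem IsRelIdeal.inf (hQ : IsQuasivariety Q) {I J : Ideal R} (hI : IsRelIdeal Q I)
    (hJ : IsRelIdeal Q J) : IsRelIdeal Q (I ⊓ J) := by
  rw [← sInf_pair]
  exact IsRelIdeal.sInf hQ (by simp [hI, hJ])

theorem IsQuasivariety.exists_isPrime_notMem (hQ : IsQuasivariety Q) {I : Ideal R}
    (hI : IsResidually (fun D _ => IsDomain D ∧ algOf D ∈ Q) (R ⧸ I)) {a : R} (ha : a ∉ I) :
    ∃ P : Ideal R, P.IsPrime ∧ IsRelIdeal Q P ∧ I ≤ P ∧ a ∉ P := by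
  obtain ⟨D, _, f, ⟨_, hD⟩, hfa⟩ := hI _ (mt Ideal.Quotient.eq_zero_iff_mem.1 ha)
  refine ⟨RingHom.ker (f.comp (Ideal.Quotient.mk I)), RingHom.ker_isPrime _,
    hQ.isRelIdeal_ker hD _, fun b hb => ?_, hfa⟩
  simp [Ideal.Quotient.eq_zero_iff_mem.2 hb]

theorem IsQuasivariety.relJoin_inf_inf_le (hQ : IsQuasivariety Q) {I : Ideal R}
    (hI : IsRelIdeal Q I) (J K : Ideal R) :
    relJoin Q (I ⊓ J) (I ⊓ K) ≤ I ⊓ relJoin Q J K := by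
  obtain ⟨⟨hjoin, hJ, hK⟩, -⟩ := isLeast_relJoin hQ J K
  exact (isLeast_relJoin hQ _ _).2
    ⟨.inf hQ hI hjoin, inf_le_inf_left I hJ, inf_le_inf_left I hK⟩

theorem IsQuasivariety.relativelyIdealDistributive (hQ : IsQuasivariety Q)
    (h : ∀ (R : Type u) [CommRing R], algOf R ∈ Q →
      IsResidually (fun D _ => IsDomain D ∧ algOf D ∈ Q) R) :
    RelativelyIdealDistributive Q := by
  refine ⟨hQ, fun R _ _ I J K hI _ _ =>
    le_antisymm (fun a ha => ?_) (hQ.relJoin_inf_inf_le hI J K)⟩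
  obtain ⟨⟨hjoin, hIJ, hIK⟩, -⟩ := isLeast_relJoin hQ (I ⊓ J) (I ⊓ K)
  by_contra hmem
  obtain ⟨P, hPprime, hP, hle, haP⟩ := hQ.exists_isPrime_notMem (h _ hjoin) hmem
  have hIP : ¬I ≤ P := fun hIP => haP (hIP ha.1)
  have hJP : J ≤ P := (hPprime.inf_le.1 (hIJ.trans hle)).resolve_left hIP
  have hKP : K ≤ P := (hPprime.inf_le.1 (hIK.trans hle)).resolve_left hIP
  exact haP ((isLeast_relJoin hQ J K).2 ⟨hP, hJP, hKP⟩ ha.2)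

end QuasiIdentities

theorem eq_algOf {A : RingAlg.{u}} [CommRing A.α]
    (hadd : ∀ x : Fin 2 → A.α, A.str.funMap Ring.addFunc x = x 0 + x 1)
    (hmul : ∀ x : Fin 2 → A.α, A.str.funMap Ring.mulFunc x = x 0 * x 1)
    (hneg : ∀ x : Fin 1 → A.α, A.str.funMap Ring.negFunc x = -x 0)
    (hzero : ∀ x : Fin 0 → A.α, A.str.funMap Ring.zeroFunc x = 0)
    (hone : ∀ x : Fin 0 → A.α, A.str.funMap Ring.oneFunc x = 1) : A = algOf A.α := by
  obtain ⟨α, str⟩ := A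
  refine congrArg (fun S => (⟨α, S⟩ : RingAlg)) (Language.Structure.ext ?_ ?_)
  · ext k f x
    cases f
    exacts [hadd x, hmul x, hneg x, hzero x, hone x]
  · ext k r
    exact r.elim

theorem exists_eq_algOf {A : RingAlg.{u}} (hA : A ∈ axiomatizedBy commRingIdentities) :
    ∃ (R : Type u) (_ : CommRing R), A = algOf R := by
  let := A.str
  let := Ring.addOfRingStructure A.α
  let := Ring.mulOfRingStructure A.α
  let := Ring.negOfRingStructure A.α
  let := Ring.zeroOfRingStructure A.α
  let := Ring.oneOfRingStructure A.α
  let := Ring.compatibleRingOfRingStructure A.α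
  simp only [axiomatizedBy, commRingIdentities, QuasiIdentity.Holds, identity, Set.mem_ofPred_eq,
    Set.mem_insert_iff, Set.mem_singleton_iff, forall_eq_or_imp, forall_eq, List.not_mem_nil,
    false_imp_iff, implies_true, true_imp_iff, Ring.realize_add, Ring.realize_mul,
    Ring.realize_neg, Ring.realize_zero, Ring.realize_one, Language.Term.realize_var] at hA
  obtain ⟨add_assoc, -, zero_add, neg_add_cancel, mul_assoc, mul_comm, one_mul, mul_add⟩ := hA
  let val (a b c : A.α) : ℕ → A.α := fun i => if i = 0 then a else if i = 1 then b else c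
  let := CommRing.ofMinimalAxioms (fun a b c => add_assoc (val a b c))
    (fun a => zero_add (val a a a)) (fun a => neg_add_cancel (val a a a))
    (fun a b c => mul_assoc (val a b c)) (fun a b => mul_comm (val a b b))
    (fun a => one_mul (val a a a)) (fun a b c => mul_add (val a b c))
  exact ⟨A.α, this, eq_algOf Ring.CompatibleRing.funMap_add Ring.CompatibleRing.funMap_mul
    Ring.CompatibleRing.funMap_neg Ring.CompatibleRing.funMap_zero Ring.CompatibleRing.funMap_one⟩

theorem algOf_mem_axiomatizedBy_commRingIdentities (R : Type u) [CommRing R] :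
    algOf R ∈ axiomatizedBy commRingIdentities := by
  let := Ring.compatibleRingOfRing R
  intro q hq
  rw [holds_algOf]
  intro v _
  simp only [commRingIdentities, Set.mem_insert_iff, Set.mem_singleton_iff] at hq
  rcases hq with rfl | rfl | rfl | rfl | rfl | rfl | rfl | rfl <;>
    simp [identity, add_assoc, mul_assoc, add_comm, mul_comm, mul_add]

theorem reducedAxiom_holds_iff {R : Type u} [CommRing R] :
    reducedAxiom.Holds (algOf R) ↔ IsReduced R := by
  let := Ring.compatibleRingOfRing R
  rw [holds_algOf, isReduced_iff_pow_one_lt 2 one_lt_two]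
  simp only [reducedAxiom, List.mem_singleton, forall_eq, Ring.realize_mul, Ring.realize_zero,
    Language.Term.realize_var, sq]
  exact ⟨fun h x => h fun _ => x, fun h v => h (v 0)⟩

theorem realize_powTerm {R : Type*} [Ring R] [Ring.CompatibleRing R] (t : RingTerm) (v : ℕ → R)
    (n : ℕ) : (powTerm t n).realize v = t.realize v ^ n := by
  induction n with
  | zero => simp [powTerm]
  | succ n ih => simp [powTerm, ih, pow_succ]

theorem unitPowAxiom_holds_iff {R : Type u} [CommRing R] {n : ℕ} :
    (unitPowAxiom n).Holds (algOf R) ↔ LocalUnitsPowEqOne n R := by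
  let := Ring.compatibleRingOfRing R
  rw [holds_algOf]
  simp only [unitPowAxiom, List.mem_singleton, forall_eq, Ring.realize_mul, realize_powTerm,
    Language.Term.realize_var]
  exact ⟨fun h x y z => h fun i => if i = 0 then x else if i = 1 then y else z,
    fun h v => h (v 0) (v 1) (v 2)⟩

/-- The axioms (a), (b), (c) that characterize membership in `quasivarietyUnitsDvd n`. -/
abbrev unitsDvdAxioms (n : ℕ) : Set QuasiIdentity :=
  commRingIdentities ∪ {reducedAxiom, unitPowAxiom n}

theorem algOf_mem_axiomatizedBy_unitsDvdAxioms_iff {R : Type u} [CommRing R] {n : ℕ} :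
    algOf R ∈ axiomatizedBy (unitsDvdAxioms n) ↔ IsReduced R ∧ LocalUnitsPowEqOne n R := by
  rw [← reducedAxiom_holds_iff, ← unitPowAxiom_holds_iff]
  refine ⟨fun h => ⟨h _ (by simp), h _ (by simp)⟩, fun ⟨hred, hpow⟩ q hq => ?_⟩
  rcases hq with hq | rfl | rfl
  exacts [algOf_mem_axiomatizedBy_commRingIdentities R q hq, hred, hpow]

theorem domainsUnitsDvd_subset_axiomatizedBy (n : ℕ) :
    domainsUnitsDvd.{u} n ⊆ axiomatizedBy (unitsDvdAxioms n) := by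
  rintro _ ⟨D, _, _, -, hcard, rfl⟩
  have hexp : Monoid.exponent Dˣ ∣ n := Group.exponent_dvd_nat_card.trans hcard
  exact algOf_mem_axiomatizedBy_unitsDvdAxioms_iff.2 ⟨inferInstance,
    localUnitsPowEqOne_iff.2 (Monoid.exponent_dvd_iff_forall_pow_eq_one.1 hexp)⟩

theorem isResidually_domainsUnitsDvd {n : ℕ} (hn : 0 < n) {R : Type u} [CommRing R]
    (hR : algOf R ∈ axiomatizedBy (unitsDvdAxioms n)) :
    IsResidually (fun D _ => IsDomain D ∧ algOf D ∈ domainsUnitsDvd n) R := by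
  obtain ⟨_, hpow⟩ := algOf_mem_axiomatizedBy_unitsDvdAxioms_iff.1 hR
  intro a ha
  obtain ⟨P, hP, haP⟩ := exists_mem_minimalPrimes_notMem ha
  have : P.IsPrime := hP.1.1
  obtain ⟨hcyclic, hcard⟩ := isCyclic_units_and_card_dvd hn
    (localUnitsPowEqOne_iff.1 (hpow.quotient_minimalPrime hP))
  exact ⟨R ⧸ P, inferInstance, Ideal.Quotient.mk P,
    ⟨inferInstance, R ⧸ P, inferInstance, inferInstance, hcyclic, hcard, rfl⟩,
    mt Ideal.Quotient.eq_zero_iff_mem.1 haP⟩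

theorem quasivarietyUnitsDvd_eq_axiomatizedBy {n : ℕ} (hn : 0 < n) :
    quasivarietyUnitsDvd.{u} n = axiomatizedBy (unitsDvdAxioms n) := by
  refine (Set.sInter_subset_of_mem
    (And.intro ⟨_, rfl⟩ (domainsUnitsDvd_subset_axiomatizedBy n))).antisymm ?_
  rintro A hA Q ⟨hQ, hdomains⟩
  obtain ⟨R, _, rfl⟩ := exists_eq_algOf fun q hq => hA q (Or.inl hq)
  exact hQ.algOf_mem_of_isResidually
    ((isResidually_domainsUnitsDvd hn hA).mono fun D _ hD => hdomains hD.2)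

theorem relativelyIdealDistributive_axiomatizedBy {n : ℕ} (hn : 0 < n) :
    RelativelyIdealDistributive (axiomatizedBy.{u} (unitsDvdAxioms n)) :=
  IsQuasivariety.relativelyIdealDistributive ⟨_, rfl⟩ fun _ _ hR =>
    (isResidually_domainsUnitsDvd hn hR).mono fun _ _ hD =>
      ⟨hD.1, domainsUnitsDvd_subset_axiomatizedBy n hD.2⟩

end RingQuasivariety

/-- The quasivariety generated by the domains with unit group cyclic of order dividing `n` is
axiomatized by the identities of commutative rings, `(x² = 0) → (x = 0)` and
`(x y z = z) → (yⁿ z = z)`, and it is a relatively ideal distributive quasivariety. -/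
theorem theorem3p1 (n : ℕ) (hn : 0 < n) :
    RingQuasivariety.quasivarietyUnitsDvd.{u} n =
        RingQuasivariety.axiomatizedBy
          (RingQuasivariety.commRingIdentities ∪
            {RingQuasivariety.reducedAxiom, RingQuasivariety.unitPowAxiom n}) ∧
      RingQuasivariety.RelativelyIdealDistributive
        (RingQuasivariety.quasivarietyUnitsDvd.{u} n) := by
  have hQ := RingQuasivariety.quasivarietyUnitsDvd_eq_axiomatizedBy hn
  exact ⟨hQ, hQ ▸ RingQuasivariety.relativelyIdealDistributive_axiomatizedBy hn⟩
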